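/- For $\theta\in[0,\pi)$ let $V_\theta\subset\mathbb{R}^2$ be the line through the origin forming angle $\theta$ with the $x$-axis. For $x\in\mathbb{R}^2$, $\alpha\in(0,\pi/2)$ and $r>0$ let $K(x,\theta,\alpha,r)=\{y\in B(x,r): \operatorname{dist}(y,V_\theta+x)<\sin(\alpha)\,|y-x|\}$, and for $E\subset\mathbb{R}^2$ and $1\le p<\infty$ put $$\mathcal{E}_{E,p}(x,\theta,\alpha,1)=\int_0^1\Big(\frac{\mathcal{H}^1(K(x,\theta,\alpha,r)\cap E)}{r}\Big)^p\,\frac{dr}{r}.$$ An $\mathcal{H}^1$-measurable set $E\subset\mathbb{R}^2$ is $1$-ADR with constant $C$ if $\mathcal{H}^1|_E$ is a Radon measure and $C^{-1}r\le\mathcal{H}^1(E\cap B(x,r))\le Cr$ for all $x\in E$ and $0<r<\operatorname{diam}(E)$. It satisfies the BPLG (big pieces of Lipschitz graphs) condition with constants $\kappa,L>0$ if for every $x\in E$ and $0<r<\operatorname{diam}(E)$ there is a Lipschitz graph $\Gamma$ (the graph, over some line, of a function that is Lipschitz with constant at most $L$) such that $\mathcal{H}^1(E\cap B(x,r)\cap\Gamma)\ge\kappa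 r$. **Proposition.** There exist absolute constants $C,\kappa>0$ such that the following holds. For every $\alpha\in(0,\pi/2)$ there are a constant $c=c(\alpha)>0$ and sets $E_N=E_N(\alpha)\subset B(0,1)\subset\mathbb{R}^2$, one for each integer $N\ge 100(1+\log_2(\alpha^{-1}))$, such that for every such $N$: 1. $E_N$ is $1$-ADR with constant $C$ and satisfies the BPLG condition with constants $\kappa$ and $L=1$; 2. for every choice of directions $\theta_x\in[0,\pi)$, $x\in E_N$, and every $1\le p<\infty$, $$\int_{E_N}\mathcal{E}_{E_N,p}(x,\theta_x,\alpha,1)\,d\mathcal{H}^1(x)\ \ge\ c\,N .$$ (If $x\mapsto\mathcal{E}_{E_N,p}(x,\theta_x,\alpha,1)$ is not measurable, the outer integral is understood as a lower integral.) -/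

import Mathlib

open MeasureTheory

noncomputable section

namespace ConicalEnergy

/-- The Euclidean plane. -/
abbrev Plane : Type := EuclideanSpace ℝ (Fin 2)

/-- One-dimensional Hausdorff measure on the plane (length of a segment = its usual length). -/
def H1 : Measure Plane := Measure.hausdorffMeasure 1

/-- The unit vector forming the angle `θ` with the positive `x`-axis. -/
def dir (θ : ℝ) : Plane := !₂[Real.cos θ, Real.sin θ]

/-- The line through the origin forming the angle `θ` with the `x`-axis. -/
def lineDir (θ : ℝ) : Submodule ℝ Plane := Submodule.span ℝ {dir θ}

/-- The open (two-sided) cone centered at `x` with direction `V` and aperture `α`: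
the points `y` with `dist (y, V + x) < sin α * |y - x|`. -/
def cone (x : Plane) (V : Submodule ℝ Plane) (α : ℝ) : Set Plane :=
  {y | Metric.infDist y {z | z - x ∈ V} < Real.sin α * dist y x}

/-- The truncated cone. -/
def truncCone (x : Plane) (V : Submodule ℝ Plane) (α r : ℝ) : Set Plane :=
  cone x V α ∩ Metric.ball x r

/-- The (one-dimensional) `(V, α, p)`-conical energy of `μ` at `x` up to scale `R`,
`∫_0^R (μ (K(x, V, α, r)) / r) ^ p dr / r`, with values in `[0, ∞]`. -/
def energy (μ : Measure Plane) (p : ℝ) (x : Plane) (V : Submodule ℝ Plane) (α R : ℝ) : ENNReal :=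
  ∫⁻ r in Set.Ioo (0 : ℝ) R,
    (μ (truncCone x V α r) / ENNReal.ofReal r) ^ p / ENNReal.ofReal r

/-- The conical energy of a set: that of the Hausdorff measure restricted to it. -/
def setEnergy (E : Set Plane) (p : ℝ) (x : Plane) (V : Submodule ℝ Plane) (α R : ℝ) : ENNReal :=
  energy (H1.restrict E) p x V α R

/-- `E` is `1`-Ahlfors-David regular with ADR constant `C`: it is `H1`-measurable, the restriction
of `H1` to `E` is a Radon measure (on the plane: a locally finite Borel measure), and
`C⁻¹ r ≤ H1 (E ∩ B(x, r)) ≤ C r` for all `x ∈ E` and `0 < r < diam E`. -/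
structure IsADRWith (C : ℝ) (E : Set Plane) : Prop where
  measurable : NullMeasurableSet E H1
  radon : IsLocallyFiniteMeasure (H1.restrict E)
  lower : ∀ x ∈ E, ∀ r : ℝ, 0 < r → ENNReal.ofReal r < Metric.ediam E →
    ENNReal.ofReal (C⁻¹ * r) ≤ H1 (E ∩ Metric.ball x r)
  upper : ∀ x ∈ E, ∀ r : ℝ, 0 < r → ENNReal.ofReal r < Metric.ediam E →
    H1 (E ∩ Metric.ball x r) ≤ ENNReal.ofReal (C * r)

/-- `Γ` is a one-dimensional Lipschitz graph with `Lip Γ ≤ L`: the graph of an `L`-Lipschitz function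
over some line through the origin, with values in the orthogonal line. -/
def IsLipschitzGraph (L : NNReal) (Γ : Set Plane) : Prop :=
  ∃ (θ : ℝ) (f : ℝ → ℝ), LipschitzWith L f ∧
    Γ = Set.range fun t : ℝ => t • dir θ + f t • dir (θ + Real.pi / 2)

/-- The big pieces of Lipschitz graphs condition with constants `κ` and `L`. -/
def HasBPLGWith (κ : ℝ) (L : NNReal) (E : Set Plane) : Prop :=
  ∀ x ∈ E, ∀ r : ℝ, 0 < r → ENNReal.ofReal r < Metric.ediam E →
    ∃ Γ : Set Plane, IsLipschitzGraph L Γ ∧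
      ENNReal.ofReal (κ * r) ≤ H1 (E ∩ Metric.ball x r ∩ Γ)

end ConicalEnergy

end

namespace ConicalEnergy

open Set Metric
open scoped Pointwise

/-! ### Lines in the plane -/

/-! Fix a finite net of directions with mesh `sin α / 4`. `tree` starts from a unit segment in the
first direction and hangs over its middle half `n` tiny copies, of ratio `1 / (8 * n)`, of the set
built from the remaining directions. A point of a copy lies within `4 * ratio n` of the segment. At
scales between about `ratio n / sin α` and `1 / 4` it therefore sees the segment as a full line
through itself, so any cone whose axis is close to that direction has density at least one. Taking
`n` comparable to `exp N / sin α` makes this range of scales have logarithmic length `N`. A point of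
the last generation sees every direction of the net in this way, each at its own scales, so
whichever direction is chosen there its energy is at least `N` (`leaves_density`, `le_setEnergy`).

Each generation keeps the fraction `n * ratio n = 1 / 8` of the mass, so the leaves have measure
`8⁻¹` to the size of the net, which depends on `α` alone (`H1_leaves`). The regularity constants
depend on neither the depth nor `n`: the masses of the generations decay geometrically, the pieces
are well separated, and all bounds are invariant under scaling (`H1_tree_inter_ball_le`,
`exists_line_le_H1_tree`). -/

lemma norm_smul_dir_add_sq (ω a b : ℝ) :
    ‖a • dir ω + b • dir (ω + Real.pi / 2)‖ ^ 2 = a ^ 2 + b ^ 2 := by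
  rw [EuclideanSpace.norm_sq_eq, Fin.sum_univ_two]
  simp only [dir, Real.cos_add_pi_div_two, Real.sin_add_pi_div_two, PiLp.add_apply,
    PiLp.smul_apply, smul_eq_mul, Real.norm_eq_abs, sq_abs, Matrix.cons_val_zero,
    Matrix.cons_val_one]
  linear_combination (a ^ 2 + b ^ 2) * Real.sin_sq_add_cos_sq ω

lemma norm_dir (ω : ℝ) : ‖dir ω‖ = 1 := by
  have h := norm_smul_dir_add_sq ω 1 0
  simp only [one_smul, zero_smul, add_zero] at h
  nlinarith [norm_nonneg (dir ω)]

lemma norm_smul_dir (ω t : ℝ) : ‖t • dir ω‖ = |t| := by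
  rw [norm_smul, norm_dir, mul_one, Real.norm_eq_abs]

lemma abs_le_norm_smul_dir_add (ω a b : ℝ) :
    |b| ≤ ‖a • dir ω + b • dir (ω + Real.pi / 2)‖ := by
  refine abs_le_of_sq_le_sq' ?_ (norm_nonneg _) |> abs_le.mpr
  rw [norm_smul_dir_add_sq]
  nlinarith [sq_nonneg a]

lemma norm_dir_sub_dir_le (ω θ : ℝ) : ‖dir ω - dir θ‖ ≤ |ω - θ| := by
  refine abs_le_of_sq_le_sq (b := |ω - θ|) ?_ (abs_nonneg _) |> (le_abs_self _).trans
  rw [EuclideanSpace.norm_sq_eq, Fin.sum_univ_two, sq_abs]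
  simp only [dir, PiLp.sub_apply, Real.norm_eq_abs, sq_abs, Matrix.cons_val_zero,
    Matrix.cons_val_one]
  have h := Real.one_sub_sq_div_two_le_cos (x := ω - θ)
  rw [Real.cos_sub] at h
  nlinarith [Real.sin_sq_add_cos_sq ω, Real.sin_sq_add_cos_sq θ]

lemma isometry_smul_dir (ω : ℝ) : Isometry fun t : ℝ => t • dir ω :=
  Isometry.of_dist_eq fun a b => by
    rw [dist_eq_norm, ← sub_smul, norm_smul_dir, Real.dist_eq]

lemma H1_image_smul_dir (ω : ℝ) (T : Set ℝ) :
    H1 ((fun t : ℝ => t • dir ω) '' T) = volume T := by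
  rw [H1, (isometry_smul_dir ω).hausdorffMeasure_image (Or.inl zero_le_one), hausdorffMeasure_real]

/-- The line through `a` in the direction `ω`. -/
def line (a : Plane) (ω : ℝ) : Set Plane := range fun t : ℝ => a + t • dir ω

/-- The big pieces will lie on straight lines, which are graphs of constant functions, so any
Lipschitz constant is allowed. -/
lemma isLipschitzGraph_line (a : Plane) (ω : ℝ) (L : NNReal) :
    IsLipschitzGraph L (line a ω) := by
  set A : ℝ := a 0 * Real.cos ω + a 1 * Real.sin ω with hA
  set B : ℝ := -a 0 * Real.sin ω + a 1 * Real.cos ω with hB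
  have ha : a = A • dir ω + B • dir (ω + Real.pi / 2) := by
    ext i
    fin_cases i
    · simp [dir, Real.cos_add_pi_div_two, Real.sin_add_pi_div_two, hA, hB]
      linear_combination (-a 0) * Real.sin_sq_add_cos_sq ω
    · simp [dir, Real.cos_add_pi_div_two, Real.sin_add_pi_div_two, hA, hB]
      linear_combination (-a 1) * Real.sin_sq_add_cos_sq ω
  refine ⟨ω, fun _ => B, LipschitzWith.const' B |>.weaken (zero_le), ?_⟩
  ext y
  constructor
  · rintro ⟨t, rfl⟩
    refine ⟨A + t, ?_⟩
    simp only
    rw [ha]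
    module
  · rintro ⟨t, rfl⟩
    refine ⟨t - A, ?_⟩
    simp only
    rw [ha]
    module

/-! ### Homotheties -/

/-- The homothety with ratio `s` followed by the translation by `c`. -/
noncomputable def scale (c : Plane) (s : ℝ) (y : Plane) : Plane := c + s • y

lemma dist_scale (c : Plane) {s : ℝ} (hs : 0 ≤ s) (y z : Plane) :
    dist (scale c s y) (scale c s z) = s * dist y z := by
  rw [scale, scale, dist_add_left, dist_smul₀, Real.norm_of_nonneg hs]

lemma continuous_scale (c : Plane) (s : ℝ) : Continuous (scale c s) := by
  unfold scale; fun_prop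

lemma H1_image_scale (c : Plane) {s : ℝ} (hs : 0 < s) (A : Set Plane) :
    H1 (scale c s '' A) = ENNReal.ofReal s * H1 A := by
  have h : scale c s '' A = (fun y => c + y) '' (s • A) := by
    rw [← image_smul, image_image]; rfl
  rw [h, H1, (isometry_add_left c).hausdorffMeasure_image (Or.inl zero_le_one),
    Measure.hausdorffMeasure_smul₀ zero_le_one hs.ne', NNReal.rpow_one, ENNReal.smul_def,
    smul_eq_mul]
  congr 1
  rw [← enorm_eq_nnnorm, Real.enorm_of_nonneg hs.le]

lemma scale_mem_truncCone {c x y : Plane} {s : ℝ} (hs : 0 < s) {V : Submodule ℝ Plane} {α r : ℝ}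
    (h : y ∈ truncCone x V α r) : scale c s y ∈ truncCone (scale c s x) V α (s * r) := by
  obtain ⟨h1, h2⟩ := h
  refine ⟨?_, ?_⟩
  · have h1 : infDist y {z | z - x ∈ V} < Real.sin α * dist y x := h1
    obtain ⟨w, hw, hyw⟩ := (infDist_lt_iff ⟨x, by simp⟩).1 h1
    have hw' : scale c s w ∈ {z | z - scale c s x ∈ V} := by
      have : scale c s w - scale c s x = s • (w - x) := by unfold scale; module
      rw [mem_ofPred_eq, this]
      exact V.smul_mem s hw
    have h3 := infDist_le_dist_of_mem (x := scale c s y) hw'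
    rw [dist_scale c hs.le] at h3
    change infDist _ _ < _
    rw [dist_scale c hs.le]
    nlinarith
  · rw [mem_ball, dist_scale c hs.le]
    exact mul_lt_mul_of_pos_left h2 hs

/-! ### The sets -/

/-- The unit segment in the direction `ω` centred at the origin. -/
def seg (ω : ℝ) : Set Plane := (fun t : ℝ => t • dir ω) '' Icc (-(1 / 2)) (1 / 2)

/-- The ratio of the scaled copies. -/
noncomputable def ratio (n : ℕ) : ℝ := (8 * (n : ℝ))⁻¹

/-- The centre of the `i`-th scaled copy: at height `3 * ratio n` over the middle half of `seg ω`. -/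
noncomputable def centre (ω : ℝ) (n i : ℕ) : Plane :=
  (-(1 / 4) + 4 * ratio n * i) • dir ω + (3 * ratio n) • dir (ω + Real.pi / 2)

/-- A segment in the first direction, with `n` scaled copies of the set built from the remaining
directions placed next to it. -/
noncomputable def tree (n : ℕ) : List ℝ → Set Plane
  | [] => seg 0
  | ω :: l => seg ω ∪ ⋃ i ∈ Finset.range n, scale (centre ω n i) (ratio n) '' tree n l

/-- The segments of the last generation of `tree n l`. -/
noncomputable def leaves (n : ℕ) : List ℝ → Set Plane
  | [] => seg 0
  | ω :: l => ⋃ i ∈ Finset.range n, scale (centre ω n i) (ratio n) '' leaves n l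

lemma isCompact_seg (ω : ℝ) : IsCompact (seg ω) :=
  isCompact_Icc.image (isometry_smul_dir ω).continuous

lemma isCompact_tree (n : ℕ) : ∀ l, IsCompact (tree n l)
  | [] => isCompact_seg 0
  | ω :: l => (isCompact_seg ω).union <| (Finset.range n).isCompact_biUnion fun _ _ =>
      (isCompact_tree n l).image (continuous_scale _ _)

lemma isCompact_leaves (n : ℕ) : ∀ l, IsCompact (leaves n l)
  | [] => isCompact_seg 0
  | _ :: l => (Finset.range n).isCompact_biUnion fun _ _ =>
      (isCompact_leaves n l).image (continuous_scale _ _)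

lemma leaves_subset_tree (n : ℕ) : ∀ l, leaves n l ⊆ tree n l
  | [] => Subset.rfl
  | _ :: l => subset_union_of_subset_right (iUnion₂_mono fun _ _ =>
      image_mono (leaves_subset_tree n l)) _

lemma ratio_pos {n : ℕ} (hn : 0 < n) : 0 < ratio n := by
  unfold ratio; positivity

lemma ratio_mul {n : ℕ} (hn : 0 < n) : ratio n * n = 1 / 8 := by
  unfold ratio; field_simp

lemma ratio_le {n : ℕ} (hn : 0 < n) : ratio n ≤ 1 / 8 := by
  have h1 : (1 : ℝ) ≤ n := by exact_mod_cast hn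
  nlinarith [ratio_mul hn, ratio_pos hn]

lemma abs_foot_le {n i : ℕ} (hi : i < n) : |-(1 / 4) + 4 * ratio n * i| ≤ 1 / 4 := by
  have hn : 0 < n := by omega
  have h1 : (i : ℝ) ≤ n := by exact_mod_cast hi.le
  have h2 := ratio_mul hn
  have h3 := ratio_pos hn
  have h4 : 0 ≤ ratio n * i := by positivity
  rw [abs_le]
  constructor <;> nlinarith

lemma norm_scale_sub_foot_le {n : ℕ} (hn : 0 < n) (ω : ℝ) (i : ℕ) {y : Plane} (hy : ‖y‖ ≤ 1) :
    ‖scale (centre ω n i) (ratio n) y - (-(1 / 4) + 4 * ratio n * i) • dir ω‖ ≤ 4 * ratio n := by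
  have hs := ratio_pos hn
  have h : scale (centre ω n i) (ratio n) y - (-(1 / 4) + 4 * ratio n * i) • dir ω =
      (3 * ratio n) • dir (ω + Real.pi / 2) + ratio n • y := by
    unfold scale centre; module
  rw [h]
  refine (norm_add_le _ _).trans ?_
  rw [norm_smul_dir, norm_smul, Real.norm_of_nonneg hs.le, abs_of_pos (by positivity)]
  nlinarith

lemma seg_subset_ball (ω : ℝ) : seg ω ⊆ ball 0 1 := by
  rintro _ ⟨t, ht, rfl⟩
  rw [mem_ball_zero_iff, norm_smul_dir]
  have := abs_le.mpr ht
  linarith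

lemma tree_subset_ball {n : ℕ} (hn : 0 < n) : ∀ l, tree n l ⊆ ball 0 1
  | [] => seg_subset_ball 0
  | ω :: l => by
    refine union_subset (seg_subset_ball ω) (iUnion₂_subset fun i hi => ?_)
    rintro _ ⟨y, hy, rfl⟩
    have hy1 := tree_subset_ball hn l hy
    rw [mem_ball_zero_iff] at hy1 ⊢
    have h1 := norm_scale_sub_foot_le hn ω i hy1.le
    have h2 := norm_le_norm_sub_add (scale (centre ω n i) (ratio n) y)
      ((-(1 / 4) + 4 * ratio n * i) • dir ω)
    rw [norm_smul_dir] at h2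
    linarith [abs_foot_le (Finset.mem_range.1 hi), ratio_le hn]

/-- Points of the segment are far from the points of the scaled copies. -/
lemma two_ratio_lt_dist_seg {n : ℕ} (hn : 0 < n) {ω : ℝ} {x y : Plane} (i : ℕ) (hx : x ∈ seg ω)
    (hy : ‖y‖ < 1) : 2 * ratio n < dist x (scale (centre ω n i) (ratio n) y) := by
  obtain ⟨t, -, rfl⟩ := hx
  have hs := ratio_pos hn
  have h1 := abs_le_norm_smul_dir_add ω ((-(1 / 4) + 4 * ratio n * i) - t) (3 * ratio n)
  have h : ((-(1 / 4) + 4 * ratio n * i) - t) • dir ω + (3 * ratio n) • dir (ω + Real.pi / 2)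
      = (scale (centre ω n i) (ratio n) y - t • dir ω) - ratio n • y := by
    unfold scale centre; module
  rw [h, abs_of_pos (by positivity)] at h1
  have h2 := norm_sub_le (scale (centre ω n i) (ratio n) y - t • dir ω) (ratio n • y)
  rw [norm_smul, Real.norm_of_nonneg hs.le] at h2
  rw [dist_comm, dist_eq_norm]
  nlinarith

lemma abs_sub_mul_lt_dist {n : ℕ} (hn : 0 < n) (ω : ℝ) {x y : Plane} (i j : ℕ) (hx : ‖x‖ < 1)
    (hy : ‖y‖ < 1) : 4 * ratio n * |(i : ℝ) - j| - 2 * ratio n <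
      dist (scale (centre ω n i) (ratio n) x) (scale (centre ω n j) (ratio n) y) := by
  have hs := ratio_pos hn
  have h : (4 * ratio n * ((i : ℝ) - j)) • dir ω =
      (scale (centre ω n i) (ratio n) x - scale (centre ω n j) (ratio n) y) -
        (ratio n • x - ratio n • y) := by
    unfold scale centre; module
  have h1 := congrArg norm h
  rw [norm_smul_dir, abs_mul, abs_of_pos (show 0 < 4 * ratio n by positivity)] at h1
  have h2 := norm_sub_le (scale (centre ω n i) (ratio n) x - scale (centre ω n j) (ratio n) y)
    (ratio n • x - ratio n • y)
  have h3 := norm_sub_le (ratio n • x) (ratio n • y)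
  rw [norm_smul, norm_smul, Real.norm_of_nonneg hs.le] at h3
  rw [dist_eq_norm]
  nlinarith

/-- The copies sit in balls of radius `ratio n` with centres spaced by `4 * ratio n`. Together with
`two_ratio_lt_dist_seg`, this lets a ball of radius below `ratio n` meet only one piece. -/
lemma eq_of_dist_scale_le {n : ℕ} (hn : 0 < n) (ω : ℝ) {x y : Plane} {i j : ℕ} (hx : ‖x‖ < 1)
    (hy : ‖y‖ < 1) (h : dist (scale (centre ω n i) (ratio n) x)
      (scale (centre ω n j) (ratio n) y) ≤ 2 * ratio n) : i = j := by
  by_contra hij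
  have h1 := abs_sub_mul_lt_dist hn ω i j hx hy
  have h2 : (1 : ℝ) ≤ |(i : ℝ) - j| := by
    have : (1 : ℤ) ≤ |(i : ℤ) - j| := Int.one_le_abs (by omega)
    exact_mod_cast this
  nlinarith [ratio_pos hn]

/-! ### Regularity -/

lemma H1_seg (ω : ℝ) : H1 (seg ω) = 1 := by
  rw [seg, H1_image_smul_dir, Real.volume_Icc]
  norm_num

/-- The bound `2` reproduces itself at every depth, since `1 + 2 / 8 ≤ 2`. -/
lemma H1_tree_le {n : ℕ} (hn : 0 < n) : ∀ l, H1 (tree n l) ≤ ENNReal.ofReal 2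
  | [] => by
    rw [tree, H1_seg]; norm_num
  | ω :: l => by
    have hs := ratio_pos hn
    have hb : H1 (⋃ i ∈ Finset.range n, scale (centre ω n i) (ratio n) '' tree n l) ≤
        ENNReal.ofReal (1 / 4) := by
      refine (measure_biUnion_finset_le _ _).trans ?_
      refine (Finset.sum_le_sum (g := fun _ => ENNReal.ofReal (ratio n * 2)) fun i _ => ?_).trans ?_
      · rw [H1_image_scale _ hs, ENNReal.ofReal_mul hs.le]
        gcongr
        exact H1_tree_le hn l
      · rw [Finset.sum_const, Finset.card_range, ← ENNReal.ofReal_nsmul, nsmul_eq_mul]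
        apply ENNReal.ofReal_le_ofReal
        linarith [ratio_mul hn]
    refine (measure_union_le _ _).trans ((add_le_add (H1_seg ω).le hb).trans ?_)
    rw [← ENNReal.ofReal_one, ← ENNReal.ofReal_add zero_le_one (by norm_num)]
    exact ENNReal.ofReal_le_ofReal (by norm_num)

lemma H1_seg_inter_ball_le (ω : ℝ) (x : Plane) (r : ℝ) :
    H1 (seg ω ∩ ball x r) ≤ ENNReal.ofReal (2 * (2 * r)) := by
  rcases (seg ω ∩ ball x r).eq_empty_or_nonempty with h | ⟨_, ⟨t, -, rfl⟩, ht⟩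
  · simp [h]
  have hsub : seg ω ∩ ball x r ⊆ (fun t : ℝ => t • dir ω) '' closedBall t (2 * r) := by
    rintro _ ⟨⟨u, -, rfl⟩, hu⟩
    refine ⟨u, ?_, rfl⟩
    rw [mem_closedBall, ← (isometry_smul_dir ω).dist_eq]
    have := dist_triangle_right (u • dir ω) (t • dir ω) x
    rw [mem_ball] at hu ht
    linarith
  refine (measure_mono hsub).trans ?_
  rw [H1_image_smul_dir, Real.volume_closedBall]

lemma card_le_of_abs_sub_le {J : Finset ℕ} {D : ℝ} (hD : 0 ≤ D)
    (h : ∀ i ∈ J, ∀ j ∈ J, |(i : ℝ) - j| ≤ D) : (J.card : ℝ) ≤ D + 1 := by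
  rcases J.eq_empty_or_nonempty with rfl | hJ
  · simp; linarith
  have hsub : J ⊆ Finset.Icc (J.min' hJ) (J.min' hJ + ⌊D⌋₊) := fun i hi => by
    have h1 := J.min'_le i hi
    have h2 := (le_abs_self _).trans (h i hi _ (J.min'_mem hJ))
    rw [Finset.mem_Icc]
    refine ⟨h1, ?_⟩
    have h3 : i - J.min' hJ ≤ ⌊D⌋₊ := Nat.le_floor (by rw [Nat.cast_sub h1]; exact h2)
    omega
  have hc := Finset.card_le_card hsub
  rw [Nat.card_Icc] at hc
  have h4 : J.card ≤ ⌊D⌋₊ + 1 := by omega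
  have h5 : (J.card : ℝ) ≤ ⌊D⌋₊ + 1 := by exact_mod_cast h4
  linarith [Nat.floor_le hD]

lemma image_scale_inter_ball_subset (c x : Plane) {s : ℝ} (hs : 0 < s) (A : Set Plane) (r : ℝ) :
    scale c s '' A ∩ ball x r ⊆ scale c s '' (A ∩ ball (s⁻¹ • (x - c)) (r / s)) := by
  rintro _ ⟨⟨y, hy, rfl⟩, hyr⟩
  refine ⟨y, ⟨hy, ?_⟩, rfl⟩
  have hx : x = scale c s (s⁻¹ • (x - c)) := by
    rw [scale, smul_inv_smul₀ hs.ne']; abel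
  rw [hx, mem_ball, dist_scale c hs.le] at hyr
  rw [mem_ball, lt_div_iff₀ hs]
  linarith

/-- The centre is arbitrary because, after rescaling a copy to unit size, it need not belong to the
set. -/
lemma H1_tree_inter_ball_le {n : ℕ} (hn : 0 < n) : ∀ l (x : Plane) {r : ℝ}, 0 < r →
    H1 (tree n l ∩ ball x r) ≤ ENNReal.ofReal (8 * r)
  | [], x, r, hr => (H1_seg_inter_ball_le 0 x r).trans (ENNReal.ofReal_le_ofReal (by linarith))
  | ω :: l, x, r, hr => by
    classical
    have hs := ratio_pos hn
    have hnorm : ∀ y ∈ tree n l, ‖y‖ < 1 := fun y hy =>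
      mem_ball_zero_iff.1 (tree_subset_ball hn l hy)
    set copy : ℕ → Set Plane := fun i => scale (centre ω n i) (ratio n) '' tree n l with hcopy
    set J := (Finset.range n).filter fun i => (copy i ∩ ball x r).Nonempty with hJ
    have hsub : tree n (ω :: l) ∩ ball x r ⊆
        (seg ω ∩ ball x r) ∪ ⋃ i ∈ J, copy i ∩ ball x r := by
      rintro y ⟨hy | hy, hyr⟩
      · exact Or.inl ⟨hy, hyr⟩
      · obtain ⟨i, hi, hy⟩ := mem_iUnion₂.1 hy
        exact Or.inr (mem_iUnion₂.2 ⟨i, Finset.mem_filter.2 ⟨hi, y, hy, hyr⟩, hy, hyr⟩)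
    -- A small ball meets either the segment or a single copy. In the second case rescaling
    -- preserves the linear bound, so no constant is lost.
    rcases lt_or_ge r (ratio n) with hrs | hrs
    · rcases J.eq_empty_or_nonempty with hJ0 | ⟨i, hi⟩
      · rw [hJ0] at hsub
        refine (measure_mono hsub).trans ?_
        simp only [Finset.notMem_empty, iUnion_of_empty, iUnion_empty, union_empty]
        exact (H1_seg_inter_ball_le ω x r).trans (ENNReal.ofReal_le_ofReal (by linarith))
      · obtain ⟨z, ⟨y, hy, rfl⟩, hz⟩ := (Finset.mem_filter.1 hi).2
        have hsub' : tree n (ω :: l) ∩ ball x r ⊆ copy i ∩ ball x r := by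
          intro w hw
          have hwd : dist w (scale (centre ω n i) (ratio n) y) ≤ 2 * ratio n := by
            have := dist_triangle_right w (scale (centre ω n i) (ratio n) y) x
            have h1 := mem_ball.1 hw.2
            have h2 := mem_ball.1 hz
            linarith
          rcases hsub hw with h | h
          · exact absurd hwd (two_ratio_lt_dist_seg hn i h.1 (hnorm y hy)).not_ge
          · obtain ⟨j, -, ⟨w, hwt, rfl⟩, hwr⟩ := mem_iUnion₂.1 h
            obtain rfl := eq_of_dist_scale_le hn ω (hnorm w hwt) (hnorm y hy) hwd
            exact ⟨⟨w, hwt, rfl⟩, hwr⟩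
        refine (measure_mono (hsub'.trans (image_scale_inter_ball_subset _ x hs _ r))).trans ?_
        rw [H1_image_scale _ hs]
        refine (mul_le_mul_right (H1_tree_inter_ball_le hn l _ (div_pos hr hs)) _).trans ?_
        rw [← ENNReal.ofReal_mul hs.le]
        apply ENNReal.ofReal_le_ofReal
        field_simp
        exact le_rfl
    -- For a large ball the copies met are counted, each with mass at most `2 * ratio n`: they
    -- contribute at most `r + 3 * ratio n ≤ 4 * r`, and the segment another `4 * r`.
    · have hcard : (J.card : ℝ) ≤ (2 * r + 2 * ratio n) / (4 * ratio n) + 1 := by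
        refine card_le_of_abs_sub_le (by positivity) fun i hi j hj => ?_
        obtain ⟨_, ⟨y, hy, rfl⟩, hyr⟩ := (Finset.mem_filter.1 hi).2
        obtain ⟨_, ⟨z, hz, rfl⟩, hzr⟩ := (Finset.mem_filter.1 hj).2
        have h1 := abs_sub_mul_lt_dist hn ω i j (hnorm y hy) (hnorm z hz)
        have h2 := dist_triangle_right (scale (centre ω n i) (ratio n) y)
          (scale (centre ω n j) (ratio n) z) x
        rw [mem_ball] at hyr hzr
        rw [le_div_iff₀ (by positivity)]
        linarith
      have hb : H1 (⋃ i ∈ J, copy i ∩ ball x r) ≤ ENNReal.ofReal (4 * r) := by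
        refine (measure_biUnion_finset_le _ _).trans ?_
        refine (Finset.sum_le_sum (g := fun _ => ENNReal.ofReal (ratio n * 2))
          fun i _ => ?_).trans ?_
        · refine (measure_mono inter_subset_left).trans ?_
          rw [hcopy, H1_image_scale _ hs, ENNReal.ofReal_mul hs.le]
          gcongr
          exact H1_tree_le hn l
        · rw [Finset.sum_const, ← ENNReal.ofReal_nsmul, nsmul_eq_mul]
          apply ENNReal.ofReal_le_ofReal
          have h1 := mul_le_mul_of_nonneg_right hcard (show 0 ≤ ratio n * 2 by positivity)
          have h2 : ((2 * r + 2 * ratio n) / (4 * ratio n) + 1) * (ratio n * 2) =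
              r + 3 * ratio n := by field_simp; ring
          linarith
      refine (measure_mono hsub).trans ((measure_union_le _ _).trans
        ((add_le_add (H1_seg_inter_ball_le ω x r) hb).trans ?_))
      rw [← ENNReal.ofReal_add (by positivity) (by positivity)]
      apply ENNReal.ofReal_le_ofReal
      linarith

lemma le_H1_seg_inter_ball {ω : ℝ} {x : Plane} (hx : x ∈ seg ω) {r : ℝ} (hr : 0 < r)
    (hr' : r ≤ 16) : ENNReal.ofReal (r / 32) ≤ H1 (seg ω ∩ ball x r ∩ line 0 ω) := by
  obtain ⟨t, ht, rfl⟩ := hx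
  obtain ⟨a, ha⟩ : ∃ a : ℝ, Ioo a (a + r / 32) ⊆ Icc (-(1 / 2)) (1 / 2) ∩ ball t r := by
    rcases le_total t 0 with h | h
    · refine ⟨t, fun u hu => ⟨⟨?_, ?_⟩, ?_⟩⟩
      · linarith [hu.1, ht.1]
      · linarith [hu.2]
      · rw [mem_ball, Real.dist_eq, abs_lt]
        constructor <;> linarith [hu.1, hu.2]
    · refine ⟨t - r / 32, fun u hu => ⟨⟨?_, ?_⟩, ?_⟩⟩
      · linarith [hu.1]
      · linarith [hu.2, ht.2]
      · rw [mem_ball, Real.dist_eq, abs_lt]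
        constructor <;> linarith [hu.1, hu.2]
  have hsub : (fun t : ℝ => t • dir ω) '' Ioo a (a + r / 32) ⊆
      seg ω ∩ ball (t • dir ω) r ∩ line 0 ω := by
    rintro _ ⟨u, hu, rfl⟩
    refine ⟨⟨⟨u, (ha hu).1, rfl⟩, ?_⟩, u, zero_add _⟩
    rw [mem_ball, (isometry_smul_dir ω).dist_eq]
    exact (ha hu).2
  refine le_trans ?_ (measure_mono hsub)
  rw [H1_image_smul_dir, Real.volume_Ioo, add_sub_cancel_left]

/-- This gives both the lower regularity bound and the big pieces. Allowing radii up to `16`, well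
beyond the diameter, covers the intermediate scales at which a copy is already small but its parent
segment is not yet close. -/
lemma exists_line_le_H1_tree {n : ℕ} (hn : 0 < n) : ∀ l, ∀ x ∈ tree n l, ∀ r : ℝ, 0 < r → r ≤ 16 →
    ∃ a ω, ENNReal.ofReal (r / 64) ≤ H1 (tree n l ∩ ball x r ∩ line a ω)
  | [], x, hx, r, hr, hr' => ⟨0, 0, le_trans (ENNReal.ofReal_le_ofReal (by linarith))
      (le_H1_seg_inter_ball hx hr hr')⟩
  | ω :: l, x, hx, r, hr, hr' => by
    have hs := ratio_pos hn
    rcases hx with hx | hx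
    · refine ⟨0, ω, le_trans (ENNReal.ofReal_le_ofReal (by linarith))
        ((le_H1_seg_inter_ball hx hr hr').trans (measure_mono ?_))⟩
      gcongr
      exact subset_union_left
    · obtain ⟨i, hi, y, hy, rfl⟩ := mem_iUnion₂.1 hx
      rcases le_or_gt r (16 * ratio n) with h | h
      · obtain ⟨a, ψ, hψ⟩ := exists_line_le_H1_tree hn l y hy (r / ratio n) (by positivity)
          (by rwa [div_le_iff₀ hs])
        refine ⟨scale (centre ω n i) (ratio n) a, ψ, ?_⟩
        have hsub : scale (centre ω n i) (ratio n) ''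
            (tree n l ∩ ball y (r / ratio n) ∩ line a ψ) ⊆ tree n (ω :: l) ∩
              ball (scale (centre ω n i) (ratio n) y) r ∩
              line (scale (centre ω n i) (ratio n) a) ψ := by
          rintro _ ⟨z, ⟨⟨hz, hzr⟩, t, rfl⟩, rfl⟩
          refine ⟨⟨Or.inr (mem_iUnion₂.2 ⟨i, hi, _, hz, rfl⟩), ?_⟩, ratio n * t, ?_⟩
          · rw [mem_ball, lt_div_iff₀ hs] at hzr
            rw [mem_ball, dist_scale _ hs.le]
            linarith
          · simp only [scale]
            module
        refine le_trans ?_ (measure_mono hsub)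
        rw [H1_image_scale _ hs]
        refine le_trans ?_ (mul_le_mul_right hψ _)
        rw [← ENNReal.ofReal_mul hs.le]
        apply ENNReal.ofReal_le_ofReal
        field_simp
        exact le_rfl
      -- Now `4 * ratio n < r / 4`, so the ball of radius `r / 2` about the foot of the copy on the
      -- segment lies inside the given ball.
      · have hfoot : (-(1 / 4) + 4 * ratio n * i) • dir ω ∈ seg ω := by
          have := abs_le.1 (abs_foot_le (Finset.mem_range.1 hi))
          exact ⟨_, ⟨by linarith, by linarith⟩, rfl⟩
        refine ⟨0, ω, le_trans (ENNReal.ofReal_le_ofReal (by linarith))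
          ((le_H1_seg_inter_ball hfoot (half_pos hr) (by linarith)).trans (measure_mono ?_))⟩
        gcongr
        · exact subset_union_left
        · apply ball_subset_ball'
          have h1 := norm_scale_sub_foot_le hn ω i
            (mem_ball_zero_iff.1 (tree_subset_ball hn l hy)).le
          rw [dist_comm, dist_eq_norm]
          linarith

lemma lt_two_of_lt_ediam_tree {n : ℕ} (hn : 0 < n) {l : List ℝ} {r : ℝ}
    (h : ENNReal.ofReal r < ediam (tree n l)) : r < 2 := by
  have h1 : ediam (tree n l) ≤ 2 * 1 := by
    refine (ediam_mono (tree_subset_ball hn l)).trans ?_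
    rw [← eball_ofReal, ENNReal.ofReal_one]
    exact ediam_eball_le
  have h2 := h.trans_le h1
  rw [mul_one] at h2
  exact ENNReal.ofReal_lt_ofNat.1 h2

lemma hasBPLGWith_tree {n : ℕ} (hn : 0 < n) (l : List ℝ) (L : NNReal) :
    HasBPLGWith (1 / 64) L (tree n l) := fun x hx r hr hd => by
  have h2 := lt_two_of_lt_ediam_tree hn hd
  obtain ⟨a, ω, h⟩ := exists_line_le_H1_tree hn l x hx r hr (by linarith)
  refine ⟨line a ω, isLipschitzGraph_line a ω L, ?_⟩
  rwa [one_div_mul_eq_div]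

lemma isADRWith_tree {n : ℕ} (hn : 0 < n) (l : List ℝ) : IsADRWith 64 (tree n l) where
  measurable := (isCompact_tree n l).measurableSet.nullMeasurableSet
  radon := by
    have : IsFiniteMeasure (H1.restrict (tree n l)) :=
      ⟨by rw [Measure.restrict_apply_univ]
          exact (H1_tree_le hn l).trans_lt ENNReal.ofReal_lt_top⟩
    infer_instance
  lower x hx r hr hd := by
    have h2 := lt_two_of_lt_ediam_tree hn hd
    obtain ⟨a, ω, h⟩ := exists_line_le_H1_tree hn l x hx r hr (by linarith)
    rw [inv_mul_eq_div]
    exact h.trans (measure_mono inter_subset_left)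
  upper x _ r hr _ := (H1_tree_inter_ball_le hn l x hr).trans
    (ENNReal.ofReal_le_ofReal (by linarith))

/-! ### Energy -/

lemma H1_leaves {n : ℕ} (hn : 0 < n) : ∀ l : List ℝ,
    H1 (leaves n l) = ENNReal.ofReal ((1 / 8) ^ l.length)
  | [] => by
    rw [leaves, H1_seg]; simp
  | ω :: l => by
    have hs := ratio_pos hn
    have hnorm : ∀ y ∈ leaves n l, ‖y‖ < 1 := fun y hy =>
      mem_ball_zero_iff.1 (tree_subset_ball hn l (leaves_subset_tree n l hy))
    rw [leaves, measure_biUnion_finset]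
    · simp_rw [H1_image_scale _ hs, H1_leaves hn l]
      rw [Finset.sum_const, Finset.card_range, ← ENNReal.ofReal_mul hs.le, ← ENNReal.ofReal_nsmul,
        nsmul_eq_mul, ← mul_assoc, mul_comm _ (ratio n), ratio_mul hn, List.length_cons, pow_succ']
    · intro i _ j _ hij
      refine Set.disjoint_left.2 ?_
      rintro _ ⟨y, hy, rfl⟩ ⟨z, hz, hzy⟩
      refine hij (eq_of_dist_scale_le hn ω (hnorm y hy) (hnorm z hz) ?_)
      rw [hzy, dist_self]
      positivity
    · exact fun i _ => ((isCompact_leaves n l).image (continuous_scale _ _)).measurableSet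

/-- A point of the segment at distance `|τ|` from the foot is within `|τ| * sin α / 4 + 4 * s` of
the axis and at least `|τ| - 4 * s` from `x`, so it is in the cone once `|τ| > 16 * s / sin α`. What
remains on the two sides has length at least `2 * r - 40 * s / sin α ≥ r`. -/
lemma le_H1_seg_inter_truncCone {ω θ α s t r : ℝ} {x : Plane} (hα : 0 < Real.sin α)
    (hs : 0 < s) (ht : |t| ≤ 1 / 4) (hx : ‖x - t • dir ω‖ ≤ 4 * s)
    (hθ : |ω - θ| ≤ Real.sin α / 4) (hr : 40 * s / Real.sin α ≤ r) (hr' : r ≤ 1 / 4) :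
    ENNReal.ofReal r ≤ H1 (seg ω ∩ truncCone x (lineDir θ) α r) := by
  set σ := Real.sin α with hσ
  have hσ1 : σ ≤ 1 := Real.sin_le_one α
  have hdiv : s ≤ s / σ := by rw [le_div_iff₀ hα]; nlinarith
  have hr0 : 40 * (s / σ) ≤ r := by rwa [← mul_div_assoc]
  set a := 16 * (s / σ) with ha
  set b := r - 4 * s with hb
  have ha0 : 0 < a := by positivity
  have key : ∀ τ : ℝ, a < |τ| → |τ| < b → (t + τ) • dir ω ∈ seg ω ∩ truncCone x (lineDir θ) α r := by
    intro τ h1 h2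
    obtain ⟨ht1, ht2⟩ := abs_le.1 ht
    obtain ⟨h21, h22⟩ := abs_lt.1 h2
    have hd : (t + τ) • dir ω - x = τ • dir ω - (x - t • dir ω) := by module
    have hlow : |τ| - 4 * s ≤ dist ((t + τ) • dir ω) x := by
      rw [dist_eq_norm, hd]
      have := norm_sub_norm_le (τ • dir ω) (x - t • dir ω)
      rw [norm_smul_dir] at this
      linarith
    refine ⟨⟨t + τ, ⟨by linarith, by linarith⟩, rfl⟩, ?_, ?_⟩
    · have hmem : x + τ • dir θ ∈ {z : Plane | z - x ∈ lineDir θ} := by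
        change x + τ • dir θ - x ∈ lineDir θ
        rw [add_sub_cancel_left]
        exact Submodule.smul_mem _ _ (Submodule.mem_span_singleton_self _)
      change infDist _ _ < _
      refine (infDist_le_dist_of_mem hmem).trans_lt ?_
      have he : (t + τ) • dir ω - (x + τ • dir θ) =
          τ • (dir ω - dir θ) - (x - t • dir ω) := by module
      have h3 : dist ((t + τ) • dir ω) (x + τ • dir θ) ≤ |τ| * (σ / 4) + 4 * s := by
        rw [dist_eq_norm, he]
        refine (norm_sub_le _ _).trans (add_le_add ?_ hx)
        rw [norm_smul, Real.norm_eq_abs]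
        exact mul_le_mul_of_nonneg_left ((norm_dir_sub_dir_le ω θ).trans hθ) (abs_nonneg _)
      have h4 : 16 * s < |τ| * σ := by
        rwa [ha, ← mul_div_assoc, div_lt_iff₀ hα] at h1
      have h5 := mul_le_mul_of_nonneg_left hlow hα.le
      nlinarith
    · rw [mem_ball, dist_eq_norm, hd]
      have := norm_sub_le (τ • dir ω) (x - t • dir ω)
      rw [norm_smul_dir] at this
      linarith
  have hsub : (fun t : ℝ => t • dir ω) '' (Ioo (t - b) (t - a) ∪ Ioo (t + a) (t + b)) ⊆
      seg ω ∩ truncCone x (lineDir θ) α r := by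
    rintro _ ⟨u, hu, rfl⟩
    have := key (u - t)
    rw [add_sub_cancel] at this
    rcases hu with hu | hu
    · have h0 : |u - t| = t - u := by rw [abs_of_neg] <;> linarith [hu.2]
      rw [h0] at this
      exact this (by linarith [hu.2]) (by linarith [hu.1])
    · have h0 : |u - t| = u - t := by rw [abs_of_pos]; linarith [hu.1]
      rw [h0] at this
      exact this (by linarith [hu.1]) (by linarith [hu.2])
  refine le_trans ?_ (measure_mono hsub)
  rw [H1_image_smul_dir, measure_union _ measurableSet_Ioo, Real.volume_Ioo, Real.volume_Ioo,
    ← ENNReal.ofReal_add (by linarith) (by linarith)]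
  · exact ENNReal.ofReal_le_ofReal (by linarith)
  · refine Set.disjoint_left.2 fun u h1 h2 => ?_
    linarith [h1.2, h2.1]

/-- From a point of the last generation, every direction of the list is visible, with density at
least one, in a range of scales of logarithmic length `K`. -/
lemma leaves_density {n : ℕ} (hn : 0 < n) {α K : ℝ} (hα : 0 < Real.sin α)
    (hK : 20 * Real.exp K / Real.sin α ≤ n) : ∀ l, ∀ x ∈ leaves n l, ∀ ω ∈ l, ∀ θ : ℝ,
      |ω - θ| ≤ Real.sin α / 4 → ∃ ρ : ℝ, 0 < ρ ∧ ρ ≤ 1 ∧ ∀ r, ρ * Real.exp (-K) < r → r < ρ →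
        ENNReal.ofReal r ≤ H1 (tree n l ∩ truncCone x (lineDir θ) α r)
  | [], _, _, ω, hω, _, _ => by simp at hω
  | ω :: l, x, hx, ψ, hψ, θ, hθ => by
    have hs := ratio_pos hn
    obtain ⟨i, hi, y, hy, rfl⟩ := mem_iUnion₂.1 hx
    have hy1 := mem_ball_zero_iff.1 (tree_subset_ball hn l (leaves_subset_tree n l hy))
    rcases List.mem_cons.1 hψ with rfl | hψ
    -- Since `ratio n = 1 / (8 * n)`, the condition `40 * ratio n / sin α ≤ exp (-K) / 4` is
    -- equivalent to `hK`.
    · refine ⟨1 / 4, by norm_num, by norm_num, fun r hr hr' => ?_⟩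
      refine (le_H1_seg_inter_truncCone hα hs (abs_foot_le (Finset.mem_range.1 hi))
        (norm_scale_sub_foot_le hn ψ i hy1.le) hθ ?_ hr'.le).trans (measure_mono ?_)
      · refine le_trans ?_ hr.le
        have hpos := Real.exp_pos K
        have h1 := ratio_mul hn
        rw [div_le_iff₀ hα] at hK ⊢
        rw [Real.exp_neg]
        have h2 := mul_le_mul_of_nonneg_left hK hs.le
        have h3 : ratio n * (n * Real.sin α) = 1 / 8 * Real.sin α := by rw [← mul_assoc, h1]
        rw [h3] at h2
        rw [mul_right_comm, ← div_eq_mul_inv, le_div_iff₀ hpos]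
        linarith
      · gcongr
        exact subset_union_left
    · obtain ⟨ρ, hρ, hρ1, h⟩ := leaves_density hn hα hK l y hy ψ hψ θ hθ
      refine ⟨ratio n * ρ, by positivity, by nlinarith [ratio_le hn], fun r hr hr' => ?_⟩
      have h1 := h (r / ratio n) (by rw [lt_div_iff₀ hs]; linarith)
        (by rw [div_lt_iff₀ hs]; linarith)
      have hsub : scale (centre ω n i) (ratio n) ''
          (tree n l ∩ truncCone y (lineDir θ) α (r / ratio n)) ⊆ tree n (ω :: l) ∩
            truncCone (scale (centre ω n i) (ratio n) y) (lineDir θ) α r := by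
        rintro _ ⟨z, ⟨hz, hzc⟩, rfl⟩
        refine ⟨Or.inr (mem_iUnion₂.2 ⟨i, hi, _, hz, rfl⟩), ?_⟩
        have := scale_mem_truncCone (c := centre ω n i) hs hzc
        rwa [mul_div_cancel₀ _ hs.ne'] at this
      refine le_trans ?_ (measure_mono hsub)
      rw [H1_image_scale _ hs]
      refine le_trans ?_ (mul_le_mul_right h1 _)
      rw [← ENNReal.ofReal_mul hs.le, mul_div_cancel₀ _ hs.ne']

/-- A density at least one stays so after raising to the power `p`, so the energy dominates the
integral of `dr / r` over the range, which is `K`. -/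
lemma le_setEnergy {E : Set Plane} {x : Plane} {V : Submodule ℝ Plane} {α p ρ K : ℝ} (hp : 0 < p)
    (hK : 0 ≤ K) (hρ : 0 < ρ) (hρ1 : ρ ≤ 1)
    (h : ∀ r, ρ * Real.exp (-K) < r → r < ρ → ENNReal.ofReal r ≤ H1 (E ∩ truncCone x V α r)) :
    ENNReal.ofReal K ≤ setEnergy E p x V α 1 := by
  have ha : 0 < ρ * Real.exp (-K) := by positivity
  have hle : ρ * Real.exp (-K) ≤ ρ :=
    mul_le_of_le_one_right hρ.le (Real.exp_le_one_iff.2 (by linarith))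
  have hint : ∫⁻ r in Ioo (ρ * Real.exp (-K)) ρ, ENNReal.ofReal r⁻¹ = ENNReal.ofReal K := by
    rw [← ofReal_integral_eq_lintegral_ofReal, ← integral_Ioc_eq_integral_Ioo,
      ← intervalIntegral.integral_of_le hle, integral_inv_of_pos ha hρ]
    · congr 1
      rw [div_mul_cancel_left₀ hρ.ne', ← Real.exp_neg, neg_neg, Real.log_exp]
    · have hc : ContinuousOn (fun r : ℝ => r⁻¹) (Icc (ρ * Real.exp (-K)) ρ) :=
        continuousOn_inv₀.mono fun r hr => (ha.trans_le hr.1).ne'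
      exact hc.integrableOn_Icc.mono_set Ioo_subset_Icc_self
    · filter_upwards [ae_restrict_mem measurableSet_Ioo] with r hr
      exact (inv_pos.2 (ha.trans hr.1)).le
  rw [← hint, setEnergy, energy]
  refine le_trans ?_ (lintegral_mono_set (Ioo_subset_Ioo ha.le hρ1))
  refine setLIntegral_mono' measurableSet_Ioo fun r hr => ?_
  have hr0 : 0 < r := ha.trans hr.1
  rw [ENNReal.ofReal_inv_of_pos hr0, ← one_div]
  gcongr
  refine ENNReal.one_le_rpow ?_ hp
  rw [ENNReal.le_div_iff_mul_le (Or.inl (by simpa using hr0)) (Or.inl ENNReal.ofReal_ne_top),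
    one_mul]
  refine (h r hr.1 hr.2).trans ?_
  rw [inter_comm]
  exact Measure.le_restrict_apply _ _

end ConicalEnergy

theorem mainTheorem2 :
    ∃ C κ : ℝ, 0 < C ∧ 0 < κ ∧
      ∀ α : ℝ, 0 < α → α < Real.pi / 2 →
        ∃ c : ℝ, 0 < c ∧ ∃ E : ℕ → Set ConicalEnergy.Plane,
          ∀ N : ℕ, 100 * (1 + Real.logb 2 α⁻¹) ≤ (N : ℝ) →
            E N ⊆ Metric.ball (0 : ConicalEnergy.Plane) 1 ∧
            ConicalEnergy.IsADRWith C (E N) ∧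
            ConicalEnergy.HasBPLGWith κ 1 (E N) ∧
            ∀ θ : ConicalEnergy.Plane → ℝ, (∀ x ∈ E N, θ x ∈ Set.Ico (0 : ℝ) Real.pi) →
              ∀ p : ℝ, 1 ≤ p →
                ENNReal.ofReal (c * (N : ℝ)) ≤
                  ∫⁻ x in E N,
                    ConicalEnergy.setEnergy (E N) p x (ConicalEnergy.lineDir (θ x)) α 1
                      ∂ConicalEnergy.H1 := by
  open ConicalEnergy in
  refine ⟨64, 1 / 64, by norm_num, by norm_num, fun α hα hα' => ?_⟩
  have hσ : 0 < Real.sin α := Real.sin_pos_of_pos_of_lt_pi hα (by linarith [Real.pi_pos])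
  set η := Real.sin α / 4 with hη
  have hη0 : 0 < η := by positivity
  -- The net does not depend on `N`; only the number `n` of copies does. Hence `c` can be the
  -- measure of the leaves.
  set l : List ℝ := (List.range (⌊Real.pi / η⌋₊ + 1)).map fun j : ℕ => (j : ℝ) * η with hl
  have hcover : ∀ θ ∈ Set.Ico (0 : ℝ) Real.pi, ∃ ω ∈ l, |ω - θ| ≤ η := by
    intro θ hθ
    refine ⟨⌊θ / η⌋₊ * η, List.mem_map.2 ⟨⌊θ / η⌋₊, List.mem_range.2 ?_, rfl⟩, ?_⟩
    · have : ⌊θ / η⌋₊ ≤ ⌊Real.pi / η⌋₊ := Nat.floor_le_floor (by gcongr; exact hθ.2.le)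
      omega
    · have h1 := Nat.floor_le (div_nonneg hθ.1 hη0.le)
      have h2 := Nat.lt_floor_add_one (θ / η)
      rw [le_div_iff₀ hη0] at h1
      rw [div_lt_iff₀ hη0] at h2
      rw [abs_le]
      constructor <;> linarith
  refine ⟨(1 / 8) ^ l.length, by positivity,
    fun N => tree ⌈20 * Real.exp N / Real.sin α⌉₊ l, fun N _ => ?_⟩
  set n := ⌈20 * Real.exp (N : ℝ) / Real.sin α⌉₊ with hn_def
  have hn : 0 < n := Nat.ceil_pos.2 (by positivity)
  refine ⟨tree_subset_ball hn l, isADRWith_tree hn l, hasBPLGWith_tree hn l 1,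
    fun θ hθ p hp => ?_⟩
  refine le_trans ?_ (lintegral_mono_set (leaves_subset_tree n l))
  have hlow : ∀ x ∈ leaves n l,
      ENNReal.ofReal N ≤ setEnergy (tree n l) p x (lineDir (θ x)) α 1 := by
    intro x hx
    obtain ⟨ω, hω, hωθ⟩ := hcover (θ x) (hθ x (leaves_subset_tree n l hx))
    obtain ⟨ρ, hρ, hρ1, h⟩ := leaves_density hn hσ (Nat.le_ceil _) l x hx ω hω (θ x) hωθ
    exact le_setEnergy (by linarith) (Nat.cast_nonneg N) hρ hρ1 h
  -- The lower bound is constant on a measurable set, so measurability of the energy in `x` plays no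
  -- role.
  refine le_trans ?_ (setLIntegral_mono' (isCompact_leaves n l).measurableSet hlow)
  rw [setLIntegral_const, H1_leaves hn, mul_comm, ENNReal.ofReal_mul (Nat.cast_nonneg N)]
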